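/- For positive integers $s_1,\dots,s_d$ with $s_1>1$ let $$\zeta(s_1,\dots,s_d)=\sum_{k_1>\dots>k_d>0}\frac{1}{k_1^{s_1}\cdots k_d^{s_d}}$$ (a convergent series). For words $u,v$ in positive integers, let $u \mathbin{\sqcup\!\sqcup} v$ be the formal sum, with multiplicity, of all interleavings of $u$ and $v$ that preserve the order of the letters of $u$ and of $v$, and extend $\zeta$ linearly to formal sums of words. Let $\{2\}^m$ be the word $2,\dots,2$ with $m$ letters, and $\{3,1\}^n$ the word $3,1,3,1,\dots,3,1$ with $2n$ letters. Then for all positive integers $m$ and $n$, every word occurring in $\{2\}^m \mathbin{\sqcup\!\sqcup} \{3,1\}^n$ has a convergent series, and $$\zeta\bigl(\{2\}^m \mathbin{\sqcup\!\sqcup} \{3,1\}^n\bigr)=\binom{2n+m}{m}\,\frac{\pi^{4n+2m}}{(2n+1)\,(4n+2m+1)!}.$$ -/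

import Mathlib

/-- The summation range of a multiple zeta value of depth `d`: tuples of integers
`k₁ > k₂ > ⋯ > k_d > 0`. -/
abbrev MZVRange (d : ℕ) : Type :=
  {k : Fin d → ℕ // StrictAnti k ∧ ∀ i, 0 < k i}

/-- The summand `1 / (k₁ ^ s₁ ⋯ k_d ^ s_d)` of `ζ(s₁, …, s_d)`. -/
noncomputable def mzvTerm (s : List ℕ) (k : MZVRange s.length) : ℝ :=
  ∏ i : Fin s.length, 1 / (k.1 i : ℝ) ^ s.get i

/-- The multiple zeta value `ζ(s₁, …, s_d)`, the sum of `1 / (k₁ ^ s₁ ⋯ k_d ^ s_d)` over all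
`k₁ > ⋯ > k_d > 0`. -/
noncomputable def mzv (s : List ℕ) : ℝ :=
  ∑' k : MZVRange s.length, mzvTerm s k

/-- The shuffle product of two words, as the list, with multiplicity, of all the interleavings
of the two words that keep the order of the letters of each. -/
def shuffle {α : Type*} : List α → List α → List (List α)
  | [], v => [v]
  | a :: u, [] => [a :: u]
  | a :: u, b :: v =>
      (shuffle u (b :: v)).map (List.cons a) ++ (shuffle (a :: u) v).map (List.cons b)
  termination_by u v => u.length + v.length

/-- The word `{2}^m`, that is `2, 2, …, 2` (`m` letters). -/
def twos (m : ℕ) : List ℕ := List.replicate m 2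

/-- The word `{3,1}^n`, that is `3, 1, 3, 1, …, 3, 1` (`2 n` letters). -/
def threeOnes (n : ℕ) : List ℕ := (List.replicate n [3, 1]).flatten

/-! The words of the theorem are handled through the multiple polylogarithms
`Li_s(X) = ∑ X ^ k₁ / (k₁ ^ s₁ ⋯ k_d ^ s_d)`, as formal power series: `ζ(s)` is the sum of the
coefficients of `Li_s` (`hasSum_mzvTerm`), and `Θ = X d/dX` lowers the first letter of `s`, or, if
that letter is `1`, removes it at the price of a factor `X / (1 - X)`.

By these rules the generating function `f_x = ∑ xᵖ Li_{{2}^p} hᵖ` satisfies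
`(1 - X) Θ² f = x h X f`. Hence `f_x f_y`, `Θ f_x Θ f_y` and `x f_x Θ f_y + y f_y Θ f_x` satisfy a
closed system of linear differential equations. The generating function
`∑ (x + y)ᵐ (4 x y)ⁿ Li_{{2}^m ⧢ {3,1}^n} h ^ (m + 2 n)`, with two companions built from the
shuffles of `{2}^m` and `1,{3,1}^n`, satisfies the same system, by splitting words at their first letter. As
solutions are unique, `f_x f_y` equals that generating function (`genTwos_mul_genTwos`).

All coefficients are nonnegative, so the case `x = y = 1` gives convergence of all the series at
`X = 1`, and evaluation there gives, for each `N`,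
`∑_{p + q = N} xᵖ y^q ζ({2}^p) ζ({2}^q) = ∑_{m + 2 n = N} (x + y)ᵐ (4 x y)ⁿ ζ({2}^m ⧢ {3,1}^n)`.
On the left `ζ({2}^p) = π ^ (2 p) / (2 p + 1)!` by Euler's product for the sine
(`hasSum_coeff_li_twos`). For `x = a²`, `y = b²` the left side is then a multiple of
`(a + b) ^ (2 N + 2) - (a - b) ^ (2 N + 2)`, and expanding `(a ± b)² = (a² + b²) ± 2 a b` shows that
the claimed values satisfy the same equation (`sum_antidiagonal_eq_sum_shuffleValue`). On the line
`x + y = 1` both right sides are polynomials in `4 x y`, so their coefficients agree. -/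

/-! ### Multiple zeta values as coefficient sums -/

/-- The operator on power series that prepends the letter `a` to a word: it sends `∑ cₖ Xᵏ` to
`∑ (∑_{j < k} cⱼ) / kᵃ Xᵏ`. -/
noncomputable def liCons (a : ℕ) : PowerSeries ℝ →ₗ[ℝ] PowerSeries ℝ where
  toFun f := PowerSeries.mk fun k => (∑ j ∈ Finset.range k, PowerSeries.coeff j f) / (k : ℝ) ^ a
  map_add' f g := by
    ext k
    simp [Finset.sum_add_distrib, add_div]
  map_smul' c f := by
    ext k
    simp [← Finset.mul_sum, mul_div_assoc]

theorem coeff_liCons (a k : ℕ) (f : PowerSeries ℝ) :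
    PowerSeries.coeff k (liCons a f) =
      (∑ j ∈ Finset.range k, PowerSeries.coeff j f) / (k : ℝ) ^ a := by
  simp [liCons]

/-- The multiple polylogarithm `Li_s` as a formal power series: the coefficient of `Xᵏ` is the sum
of `1 / (k₁ ^ s₁ ⋯ k_d ^ s_d)` over `k = k₁ > ⋯ > k_d > 0`. -/
noncomputable def li : List ℕ → PowerSeries ℝ
  | [] => 1
  | a :: s => liCons a (li s)

theorem coeff_li_nonneg (s : List ℕ) (k : ℕ) : 0 ≤ PowerSeries.coeff k (li s) := by
  induction s generalizing k with
  | nil =>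
    rw [li, PowerSeries.coeff_one]
    split_ifs <;> norm_num
  | cons a s ih =>
    rw [li, coeff_liCons]
    exact div_nonneg (Finset.sum_nonneg fun j _ => ih j) (by positivity)

theorem mzvTerm_nonneg (s : List ℕ) (k : MZVRange s.length) : 0 ≤ mzvTerm s k :=
  Finset.prod_nonneg fun i _ => by positivity

theorem mzvTerm_cons (a : ℕ) (s : List ℕ) (k : MZVRange (a :: s).length)
    (k' : MZVRange s.length) (h : ∀ i, k'.1 i = k.1 (Fin.succ i)) :
    mzvTerm (a :: s) k = 1 / (k.1 (0 : Fin (s.length + 1)) : ℝ) ^ a * mzvTerm s k' := by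
  unfold mzvTerm
  simp only [h]
  exact Fin.prod_univ_succ (n := s.length) fun i => 1 / (k.1 i : ℝ) ^ (a :: s).get i

open Classical in
/-- The part of the series `ζ(s)` with all indices less than `N`, in `[0, ∞]`. The full series is
the case `N = ⊤`. -/
noncomputable def mzvBelow (s : List ℕ) (N : ℕ∞) : ENNReal :=
  ∑' k : MZVRange s.length,
    if ∀ i, (k.1 i : ℕ∞) < N then ENNReal.ofReal (mzvTerm s k) else 0

open Classical in
theorem mzvBelow_cons (a : ℕ) (s : List ℕ) (N : ℕ∞) :
    mzvBelow (a :: s) N = ∑' j : ℕ, if 0 < j ∧ (j : ℕ∞) < N then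
      ENNReal.ofReal (1 / (j : ℝ) ^ a) * mzvBelow s j else 0 := by
  let f : ℕ × MZVRange s.length → ENNReal := fun q =>
    if (0 < q.1 ∧ (q.1 : ℕ∞) < N) ∧ ∀ i, (q.2.1 i : ℕ∞) < (q.1 : ℕ∞) then
      ENNReal.ofReal (1 / (q.1 : ℝ) ^ a) * ENNReal.ofReal (mzvTerm s q.2) else 0
  let g : MZVRange (s.length + 1) → ℕ × MZVRange s.length := fun k =>
    (k.1 0, ⟨fun i => k.1 i.succ, fun i j hij => k.2.1 (Fin.succ_lt_succ_iff.2 hij),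
      fun i => k.2.2 _⟩)
  have hg : Function.Injective g := by
    intro k l hkl
    have h0 := congrArg Prod.fst hkl
    have h1 := congrArg (fun q => q.2.1) hkl
    apply Subtype.ext
    funext i
    refine Fin.cases h0 (fun j => congrFun h1 j) i
  have hsupp : Function.support f ⊆ Set.range g := by
    rintro ⟨j, k⟩ hjk
    have hc : (0 < j ∧ (j : ℕ∞) < N) ∧ ∀ i, (k.1 i : ℕ∞) < (j : ℕ∞) := by
      by_contra hc
      exact hjk (if_neg hc)
    refine ⟨⟨Fin.cons j k.1, ?_, ?_⟩, ?_⟩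
    · intro x y
      refine Fin.cases ?_ (fun x => ?_) x <;> refine Fin.cases ?_ (fun y => ?_) y
      · intro h
        exact absurd h (lt_irrefl _)
      · intro _
        simpa using hc.2 y
      · intro h
        exact absurd h (Fin.not_lt_zero _)
      · intro h
        simpa using k.2.1 (Fin.succ_lt_succ_iff.1 h)
    · intro x
      refine Fin.cases ?_ (fun x => ?_) x
      · simpa using hc.1.1
      · simpa using k.2.2 x
    · simp [g]
  have h1 : mzvBelow (a :: s) N = ∑' k, f (g k) := by
    unfold mzvBelow
    refine tsum_congr fun k => ?_
    change MZVRange (s.length + 1) at k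
    have hiff : (∀ i : Fin (s.length + 1), (k.1 i : ℕ∞) < N) ↔
        (0 < (g k).1 ∧ ((g k).1 : ℕ∞) < N) ∧ ∀ i, ((g k).2.1 i : ℕ∞) < ((g k).1 : ℕ∞) := by
      constructor
      · intro h
        exact ⟨⟨k.2.2 0, h 0⟩, fun i => by
          exact_mod_cast k.2.1 (Fin.succ_pos i)⟩
      · rintro ⟨⟨_, h0⟩, h⟩ i
        exact Fin.cases h0 (fun j => (h j).trans h0) i
    have hterm := mzvTerm_cons a s k (g k).2 fun i => rfl
    by_cases hc : ∀ i : Fin (s.length + 1), (k.1 i : ℕ∞) < N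
    · refine (if_pos hc).trans ?_
      simp only [f]
      rw [if_pos (hiff.1 hc), ← ENNReal.ofReal_mul (by positivity), hterm]
    · refine (if_neg hc).trans ?_
      simp only [f]
      rw [if_neg (fun h => hc (hiff.2 h))]
  rw [h1, hg.tsum_eq hsupp, ENNReal.tsum_prod']
  refine tsum_congr fun j => ?_
  by_cases hj : 0 < j ∧ (j : ℕ∞) < N
  · rw [if_pos hj, mzvBelow, ← ENNReal.tsum_mul_left]
    refine tsum_congr fun k => ?_
    simp only [f, hj, true_and, and_self, mul_ite, mul_zero]
  · rw [if_neg hj]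
    simp [f, hj]

theorem mzvBelow_nil (N : ℕ∞) : mzvBelow [] N = 1 := by
  have : Unique (MZVRange ([] : List ℕ).length) :=
    { default := ⟨fun i => i.elim0, fun i => i.elim0, fun i => i.elim0⟩
      uniq := fun k => Subtype.ext (funext fun i => i.elim0) }
  rw [mzvBelow, tsum_fintype, Fintype.sum_unique]
  rw [if_pos fun i => i.elim0]
  simp [mzvTerm]

/-- The positivity of `N` matters for the empty word, whose only (empty) tuple is counted by every
`N`, while its coefficient sits at index `0`. -/
theorem mzvBelow_cast (s : List ℕ) (N : ℕ) (hN : 0 < N) :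
    mzvBelow s N = ENNReal.ofReal (∑ j ∈ Finset.range N, PowerSeries.coeff j (li s)) := by
  induction s generalizing N with
  | nil =>
    rw [mzvBelow_nil, li]
    simp [PowerSeries.coeff_one, hN]
  | cons a s ih =>
    rw [mzvBelow_cons, ENNReal.ofReal_sum_of_nonneg fun j _ => coeff_li_nonneg _ j,
      tsum_eq_sum (s := Finset.range N)]
    · refine Finset.sum_congr rfl fun j hj => ?_
      rw [li, coeff_liCons]
      rcases Nat.eq_zero_or_pos j with rfl | h0
      · simp
      · rw [if_pos ⟨h0, by exact_mod_cast Finset.mem_range.1 hj⟩, ih j h0,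
          ← ENNReal.ofReal_mul (by positivity), one_div_mul_eq_div]
    · intro j hj
      rw [if_neg]
      rintro ⟨_, h⟩
      exact hj (Finset.mem_range.2 (by exact_mod_cast h))

/-- The sum over all tuples, grouped by the leading index. In `[0, ∞]` no convergence is needed. -/
theorem tsum_ofReal_mzvTerm (s : List ℕ) :
    ∑' k, ENNReal.ofReal (mzvTerm s k) =
      ∑' k, ENNReal.ofReal (PowerSeries.coeff k (li s)) := by
  have h : ∑' k, ENNReal.ofReal (mzvTerm s k) = mzvBelow s ⊤ := by
    simp [mzvBelow]
  rw [h]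
  cases s with
  | nil =>
    rw [mzvBelow_nil, tsum_eq_single 0]
    · simp [li]
    · intro k hk
      simp [li, PowerSeries.coeff_one, hk]
  | cons a s =>
    rw [mzvBelow_cons]
    refine tsum_congr fun j => ?_
    rw [li, coeff_liCons]
    rcases Nat.eq_zero_or_pos j with rfl | h0
    · simp
    · rw [if_pos ⟨h0, by simp⟩, mzvBelow_cast s j h0,
        ← ENNReal.ofReal_mul (by positivity), one_div_mul_eq_div]

/-- The series `ζ(s)` may be summed by its leading index: this is `ζ(s) = Li_s(1)`, for
convergence as well as for the value. -/
theorem hasSum_mzvTerm {s : List ℕ} (h : Summable fun k => PowerSeries.coeff k (li s)) :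
    HasSum (mzvTerm s) (∑' k, PowerSeries.coeff k (li s)) := by
  have h1 := tsum_ofReal_mzvTerm s
  rw [← ENNReal.ofReal_tsum_of_nonneg (coeff_li_nonneg s) h] at h1
  have h2 : Summable (mzvTerm s) := by
    have h3 : Summable fun k => (ENNReal.ofReal (mzvTerm s k)).toReal :=
      ENNReal.summable_toReal (by rw [h1]; exact ENNReal.ofReal_ne_top)
    simpa only [ENNReal.toReal_ofReal (mzvTerm_nonneg s _)] using h3
  rw [← ENNReal.ofReal_tsum_of_nonneg (mzvTerm_nonneg s) h2,
    ENNReal.ofReal_eq_ofReal_iff (tsum_nonneg (mzvTerm_nonneg s))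
      (tsum_nonneg (coeff_li_nonneg s))] at h1
  exact h1 ▸ h2.hasSum

/-! ### Differential equations for the generating functions -/

/-- The Euler operator `X d/dX` on power series. -/
noncomputable def eulerOp : Derivation ℝ (PowerSeries ℝ) (PowerSeries ℝ) :=
  (PowerSeries.X : PowerSeries ℝ) • PowerSeries.derivative ℝ

theorem coeff_eulerOp (f : PowerSeries ℝ) (k : ℕ) :
    PowerSeries.coeff k (eulerOp f) = k * PowerSeries.coeff k f := by
  change PowerSeries.coeff k (PowerSeries.X * PowerSeries.derivative ℝ f) = _
  cases k with
  | zero => simp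
  | succ k =>
    rw [PowerSeries.coeff_succ_X_mul, PowerSeries.coeff_derivative]
    push_cast
    ring

theorem eulerOp_liCons (a : ℕ) (f : PowerSeries ℝ) :
    eulerOp (liCons (a + 2) f) = liCons (a + 1) f := by
  ext k
  rw [coeff_eulerOp, coeff_liCons, coeff_liCons]
  rcases Nat.eq_zero_or_pos k with rfl | hk
  · simp
  · have : (k : ℝ) ≠ 0 := by positivity
    field_simp
    ring

theorem one_sub_X_mul_eulerOp_liCons (f : PowerSeries ℝ) :
    (1 - PowerSeries.X) * eulerOp (liCons 1 f) = PowerSeries.X * f := by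
  have key : ∀ k, PowerSeries.coeff k (eulerOp (liCons 1 f)) =
      ∑ j ∈ Finset.range k, PowerSeries.coeff j f := by
    intro k
    rw [coeff_eulerOp, coeff_liCons]
    rcases Nat.eq_zero_or_pos k with rfl | hk
    · simp
    · have : (k : ℝ) ≠ 0 := by positivity
      field_simp
  ext k
  rw [sub_mul, one_mul, map_sub]
  cases k with
  | zero => simp [key]
  | succ k =>
    rw [PowerSeries.coeff_succ_X_mul, PowerSeries.coeff_succ_X_mul, key, key,
      Finset.sum_range_succ]
    ring

theorem eq_zero_of_eulerOp_eq_zero {f : PowerSeries ℝ} (h0 : PowerSeries.coeff 0 f = 0)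
    (h : eulerOp f = 0) : f = 0 := by
  ext k
  have hk := congrArg (PowerSeries.coeff k) h
  rw [coeff_eulerOp, map_zero] at hk
  rcases Nat.eq_zero_or_pos k with rfl | hk0
  · simpa using h0
  · have : (k : ℝ) ≠ 0 := by positivity
    simpa [this] using hk

theorem eq_zero_of_one_sub_X_mul {f : PowerSeries ℝ} (h : (1 - PowerSeries.X) * f = 0) :
    f = 0 := by
  rcases mul_eq_zero.1 h with h | h
  · have := congrArg (PowerSeries.coeff 0) h
    simp at this
  · exact h

/-- The Euler operator `X d/dX` applied coefficientwise to power series in a second variable. -/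
noncomputable def eulerOpCoeff :
    Derivation ℝ (PowerSeries (PowerSeries ℝ)) (PowerSeries (PowerSeries ℝ)) :=
  Derivation.mk'
    { toFun := fun F => PowerSeries.mk fun N => eulerOp (PowerSeries.coeff N F)
      map_add' := fun F G => by
        ext1 N
        simp
      map_smul' := fun c F => by
        ext1 N
        simp [PowerSeries.coeff_mk] }
    (fun F G => by
      ext1 N
      simp [PowerSeries.coeff_mul, Finset.sum_add_distrib, smul_eq_mul]
      rw [← Finset.Nat.sum_antidiagonal_swap]
      simp)

theorem coeff_eulerOpCoeff (F : PowerSeries (PowerSeries ℝ)) (N : ℕ) :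
    PowerSeries.coeff N (eulerOpCoeff F) = eulerOp (PowerSeries.coeff N F) := by
  change PowerSeries.coeff N (PowerSeries.mk fun N => eulerOp (PowerSeries.coeff N F)) = _
  rw [PowerSeries.coeff_mk]

theorem eulerOpCoeff_X : eulerOpCoeff PowerSeries.X = 0 := by
  ext1 N
  rw [coeff_eulerOpCoeff, PowerSeries.coeff_X]
  split_ifs <;> simp

/-- A real number as a constant of the ring `ℝ⟦X⟧⟦h⟧`. -/
noncomputable abbrev scalar (x : ℝ) : PowerSeries (PowerSeries ℝ) :=
  PowerSeries.C (PowerSeries.C x)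

theorem eulerOpCoeff_scalar (x : ℝ) : eulerOpCoeff (scalar x) = 0 := by
  have h := eulerOpCoeff.map_algebraMap x
  rwa [PowerSeries.algebraMap_apply, PowerSeries.algebraMap_apply] at h

/-- Uniqueness for the linear system satisfied by a product of two solutions of
`(1 - X) Θ² f = x h X f`, with `Θ = X d/dX`. The equations determine the coefficient of `h ^ N`
from that of `h ^ (N - 1)`, up to constants of integration. -/
theorem system_eq_zero {s t : ℝ} {u v w : PowerSeries (PowerSeries ℝ)}
    (hu0 : ∀ N, PowerSeries.coeff 0 (PowerSeries.coeff N u) = 0)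
    (hv0 : ∀ N, PowerSeries.coeff 0 (PowerSeries.coeff N v) = 0)
    (hw0 : ∀ N, PowerSeries.coeff 0 (PowerSeries.coeff N w) = 0)
    (hu : PowerSeries.C (1 - PowerSeries.X) * eulerOpCoeff (eulerOpCoeff u) =
      PowerSeries.X * (PowerSeries.C (PowerSeries.X * PowerSeries.C s) * u) +
        PowerSeries.C (2 * (1 - PowerSeries.X)) * v)
    (hv : PowerSeries.C (1 - PowerSeries.X) * eulerOpCoeff v =
      PowerSeries.X * (PowerSeries.C PowerSeries.X * w))
    (hw : PowerSeries.C (1 - PowerSeries.X) * eulerOpCoeff w =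
      PowerSeries.C ((1 - PowerSeries.X) * PowerSeries.C s) * v +
        PowerSeries.X * (PowerSeries.C (PowerSeries.X * PowerSeries.C t) * u)) :
    u = 0 := by
  have step : ∀ N, (∀ F : PowerSeries (PowerSeries ℝ), F = u ∨ F = w →
      ∀ g, PowerSeries.coeff N (PowerSeries.X * (PowerSeries.C g * F)) = 0) →
      PowerSeries.coeff N u = 0 ∧ PowerSeries.coeff N w = 0 := by
    intro N hN
    have hvN : PowerSeries.coeff N v = 0 := by
      refine eq_zero_of_eulerOp_eq_zero (hv0 N) (eq_zero_of_one_sub_X_mul ?_)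
      have := congrArg (PowerSeries.coeff N) hv
      rwa [PowerSeries.coeff_C_mul, coeff_eulerOpCoeff, hN w (Or.inr rfl)] at this
    constructor
    · refine eq_zero_of_eulerOp_eq_zero (hu0 N) (eq_zero_of_eulerOp_eq_zero ?_
        (eq_zero_of_one_sub_X_mul ?_))
      · simp [coeff_eulerOp]
      · have := congrArg (PowerSeries.coeff N) hu
        rwa [map_add, PowerSeries.coeff_C_mul, PowerSeries.coeff_C_mul, coeff_eulerOpCoeff,
          coeff_eulerOpCoeff, hN u (Or.inl rfl), hvN, mul_zero, add_zero] at this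
    · refine eq_zero_of_eulerOp_eq_zero (hw0 N) (eq_zero_of_one_sub_X_mul ?_)
      have := congrArg (PowerSeries.coeff N) hw
      rwa [map_add, PowerSeries.coeff_C_mul, PowerSeries.coeff_C_mul, coeff_eulerOpCoeff,
        hN u (Or.inl rfl), hvN, mul_zero, add_zero] at this
  have all : ∀ N, PowerSeries.coeff N u = 0 ∧ PowerSeries.coeff N w = 0 := by
    intro N
    induction N with
    | zero => exact step 0 fun F _ g => by simp
    | succ N ih =>
      refine step _ fun F hF g => ?_
      rw [PowerSeries.coeff_succ_X_mul, PowerSeries.coeff_C_mul]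
      rcases hF with rfl | rfl
      · rw [ih.1, mul_zero]
      · rw [ih.2, mul_zero]
  ext1 N
  simpa using (all N).1

/-! ### Generating functions of shuffles -/

/-- The sum of `Li_w` over the words `w` in the shuffle of `{2}^m` and `{3,1}^n`. -/
noncomputable def liShuffle (m n : ℕ) : PowerSeries ℝ :=
  ((shuffle (twos m) (threeOnes n)).map li).sum

/-- The sum of `Li_w` over the words `w` in the shuffle of `{2}^m` and `1,{3,1}^n`. -/
noncomputable def liShuffleOne (m n : ℕ) : PowerSeries ℝ :=
  ((shuffle (twos m) (1 :: threeOnes n)).map li).sum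

theorem sum_map_li_cons (a : ℕ) (l : List (List ℕ)) :
    ((l.map (List.cons a)).map li).sum = liCons a (l.map li).sum := by
  rw [map_list_sum, List.map_map, List.map_map]
  rfl

theorem twos_succ (m : ℕ) : twos (m + 1) = 2 :: twos m := rfl

theorem threeOnes_succ (n : ℕ) : threeOnes (n + 1) = 3 :: 1 :: threeOnes n := rfl

theorem shuffle_nil_right {α : Type*} (u : List α) : shuffle u [] = [u] := by
  cases u <;> rw [shuffle]

theorem liShuffle_zero_right (m : ℕ) : liShuffle m 0 = li (twos m) := by
  simp [liShuffle, threeOnes, shuffle_nil_right]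

theorem liShuffle_zero_zero : liShuffle 0 0 = 1 := by
  rw [liShuffle_zero_right]
  rfl

theorem liShuffle_succ_zero (m : ℕ) : liShuffle (m + 1) 0 = liCons 2 (liShuffle m 0) := by
  rw [liShuffle_zero_right, liShuffle_zero_right]
  rfl

theorem liShuffle_zero_succ (n : ℕ) : liShuffle 0 (n + 1) = liCons 3 (liShuffleOne 0 n) := by
  simp [liShuffle, liShuffleOne, twos, threeOnes_succ, shuffle, li]

theorem liShuffle_succ_succ (m n : ℕ) : liShuffle (m + 1) (n + 1) =
    liCons 2 (liShuffle m (n + 1)) + liCons 3 (liShuffleOne (m + 1) n) := by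
  rw [liShuffle, twos_succ, threeOnes_succ, shuffle, List.map_append, List.sum_append,
    sum_map_li_cons, sum_map_li_cons]
  rfl

theorem liShuffleOne_zero (n : ℕ) : liShuffleOne 0 n = liCons 1 (liShuffle 0 n) := by
  simp [liShuffle, liShuffleOne, twos, shuffle, li]

theorem liShuffleOne_succ (m n : ℕ) : liShuffleOne (m + 1) n =
    liCons 2 (liShuffleOne m n) + liCons 1 (liShuffle (m + 1) n) := by
  rw [liShuffleOne, twos_succ, shuffle, List.map_append, List.sum_append,
    sum_map_li_cons, sum_map_li_cons]
  rfl

/-- `∑ sᵐ tⁿ g(m, n) h ^ (m + 2 n)`, as a power series in `h`. -/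
noncomputable def gen (s t : ℝ) (g : ℕ → ℕ → PowerSeries ℝ) : PowerSeries (PowerSeries ℝ) :=
  PowerSeries.mk fun N => ∑ n ∈ Finset.range (N + 1),
    if 2 * n ≤ N then (s ^ (N - 2 * n) * t ^ n) • g (N - 2 * n) n else 0

theorem coeff_gen (s t : ℝ) (g : ℕ → ℕ → PowerSeries ℝ) (N : ℕ) :
    PowerSeries.coeff N (gen s t g) = ∑ n ∈ Finset.range (N + 1),
      if 2 * n ≤ N then (s ^ (N - 2 * n) * t ^ n) • g (N - 2 * n) n else 0 :=
  PowerSeries.coeff_mk _ _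

theorem gen_add (s t : ℝ) (f g : ℕ → ℕ → PowerSeries ℝ) :
    gen s t (fun m n => f m n + g m n) = gen s t f + gen s t g := by
  ext1 N
  rw [map_add, coeff_gen, coeff_gen, coeff_gen, ← Finset.sum_add_distrib]
  refine Finset.sum_congr rfl fun n _ => ?_
  split_ifs <;> simp

theorem eulerOpCoeff_gen (s t : ℝ) (g : ℕ → ℕ → PowerSeries ℝ) :
    eulerOpCoeff (gen s t g) = gen s t fun m n => eulerOp (g m n) := by
  ext1 N
  rw [coeff_eulerOpCoeff, coeff_gen, coeff_gen, map_sum]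
  refine Finset.sum_congr rfl fun n _ => ?_
  split_ifs
  · rw [Derivation.map_smul]
  · rw [map_zero]

theorem C_mul_gen (s t : ℝ) (a : PowerSeries ℝ) (g : ℕ → ℕ → PowerSeries ℝ) :
    PowerSeries.C a * gen s t g = gen s t fun m n => a * g m n := by
  ext1 N
  rw [PowerSeries.coeff_C_mul, coeff_gen, coeff_gen, Finset.mul_sum]
  refine Finset.sum_congr rfl fun n _ => ?_
  split_ifs
  · rw [mul_smul_comm]
  · rw [mul_zero]

/-- The array `g` shifted by one in its first argument. -/
noncomputable def shiftLeft (g : ℕ → ℕ → PowerSeries ℝ) : ℕ → ℕ → PowerSeries ℝ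
  | 0, _ => 0
  | m + 1, n => g m n

/-- The array `g` shifted by one in its second argument. -/
noncomputable def shiftRight (g : ℕ → ℕ → PowerSeries ℝ) : ℕ → ℕ → PowerSeries ℝ
  | _, 0 => 0
  | m, n + 1 => g m n

theorem gen_shiftLeft (s t : ℝ) (g : ℕ → ℕ → PowerSeries ℝ) :
    gen s t (shiftLeft g) = PowerSeries.X * (scalar s * gen s t g) := by
  ext1 N
  cases N with
  | zero => simp [coeff_gen, shiftLeft]
  | succ N =>
    rw [PowerSeries.coeff_succ_X_mul, PowerSeries.coeff_C_mul, coeff_gen, coeff_gen,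
      Finset.sum_range_succ, if_neg (by omega), add_zero, Finset.mul_sum]
    refine Finset.sum_congr rfl fun n _ => ?_
    by_cases h : 2 * n ≤ N
    · have e : N + 1 - 2 * n = N - 2 * n + 1 := by omega
      rw [if_pos h, if_pos (by omega), e, shiftLeft, ← PowerSeries.smul_eq_C_mul, smul_smul]
      congr 1
      ring
    · rw [if_neg h, mul_zero]
      split_ifs with h'
      · have e : N + 1 - 2 * n = 0 := by omega
        rw [e, shiftLeft, smul_zero]
      · rfl

theorem gen_shiftRight (s t : ℝ) (g : ℕ → ℕ → PowerSeries ℝ) :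
    gen s t (shiftRight g) = PowerSeries.X ^ 2 * (scalar t * gen s t g) := by
  ext1 N
  rw [PowerSeries.coeff_X_pow_mul']
  rcases Nat.lt_or_ge N 2 with hN | hN
  · rw [if_neg (by omega), coeff_gen]
    refine Finset.sum_eq_zero fun n _ => ?_
    split_ifs with h
    · have : n = 0 := by omega
      rw [this, shiftRight, smul_zero]
    · rfl
  · obtain ⟨M, rfl⟩ := Nat.exists_eq_add_of_le' hN
    rw [if_pos hN, Nat.add_sub_cancel, PowerSeries.coeff_C_mul, coeff_gen, coeff_gen,
      Finset.sum_range_succ', Finset.sum_range_succ, if_neg (by omega), add_zero]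
    simp only [shiftRight, smul_zero, ite_self, add_zero]
    rw [Finset.mul_sum]
    refine Finset.sum_congr rfl fun n _ => ?_
    by_cases h : 2 * n ≤ M
    · have e : M + 2 - 2 * (n + 1) = M - 2 * n := by omega
      rw [if_pos h, if_pos (by omega), e, ← PowerSeries.smul_eq_C_mul, smul_smul]
      congr 1
      ring
    · rw [if_neg h, if_neg (by omega), mul_zero]

/-- The words of the shuffle, split by their first letter, which is `2` or `3`. -/
theorem eulerOp_liShuffle (m n : ℕ) : eulerOp (liShuffle m n) =
    shiftLeft (fun m n => liCons 1 (liShuffle m n)) m n +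
      shiftRight (fun m n => liCons 2 (liShuffleOne m n)) m n := by
  cases m <;> cases n
  · simp [liShuffle_zero_zero, shiftLeft, shiftRight]
  · simp [liShuffle_zero_succ, shiftLeft, shiftRight, eulerOp_liCons]
  · simp [liShuffle_succ_zero, shiftLeft, shiftRight, eulerOp_liCons]
  · simp [liShuffle_succ_succ, shiftLeft, shiftRight, eulerOp_liCons]

/-- The words of the shuffle, split by their first letter, which is `2` or `1`. -/
theorem eulerOp_liShuffleOne (m n : ℕ) : eulerOp (liShuffleOne m n) =
    shiftLeft (fun m n => liCons 1 (liShuffleOne m n)) m n +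
      eulerOp (liCons 1 (liShuffle m n)) := by
  cases m
  · simp [liShuffleOne_zero, shiftLeft]
  · simp [liShuffleOne_succ, shiftLeft, eulerOp_liCons]

theorem C_mul_eulerOpCoeff_gen (s t : ℝ) (g : ℕ → ℕ → PowerSeries ℝ) :
    PowerSeries.C (1 - PowerSeries.X) * eulerOpCoeff (gen s t fun m n => liCons 1 (g m n)) =
      PowerSeries.C PowerSeries.X * gen s t g := by
  rw [eulerOpCoeff_gen, C_mul_gen, C_mul_gen]
  simp only [one_sub_X_mul_eulerOp_liCons]

theorem eulerOpCoeff_X_mul (F : PowerSeries (PowerSeries ℝ)) :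
    eulerOpCoeff (PowerSeries.X * F) = PowerSeries.X * eulerOpCoeff F := by
  rw [Derivation.leibniz, eulerOpCoeff_X, smul_zero, add_zero, smul_eq_mul]

theorem eulerOpCoeff_scalar_mul (x : ℝ) (F : PowerSeries (PowerSeries ℝ)) :
    eulerOpCoeff (scalar x * F) = scalar x * eulerOpCoeff F := by
  rw [Derivation.leibniz, eulerOpCoeff_scalar, smul_zero, add_zero, smul_eq_mul]

theorem eulerOpCoeff_gen_liShuffle (s t : ℝ) :
    PowerSeries.C (1 - PowerSeries.X) * eulerOpCoeff (eulerOpCoeff (gen s t liShuffle)) =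
      PowerSeries.X * (scalar s * (PowerSeries.C PowerSeries.X * gen s t liShuffle)) +
      PowerSeries.X ^ 2 * (scalar t * (PowerSeries.C (1 - PowerSeries.X) *
        gen s t fun m n => liCons 1 (liShuffleOne m n))) := by
  have h1 : eulerOpCoeff (gen s t liShuffle) =
      PowerSeries.X * (scalar s * gen s t fun m n => liCons 1 (liShuffle m n)) +
      PowerSeries.X * (PowerSeries.X *
        (scalar t * gen s t fun m n => liCons 2 (liShuffleOne m n))) := by
    rw [← mul_assoc PowerSeries.X PowerSeries.X, ← pow_two, ← gen_shiftLeft, ← gen_shiftRight,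
      ← gen_add, eulerOpCoeff_gen]
    simp only [eulerOp_liShuffle]
  have h2 : eulerOpCoeff (gen s t fun m n => liCons 2 (liShuffleOne m n)) =
      gen s t fun m n => liCons 1 (liShuffleOne m n) := by
    rw [eulerOpCoeff_gen]
    simp only [eulerOp_liCons 0]
  have h3 := C_mul_eulerOpCoeff_gen s t liShuffle
  rw [h1, map_add, eulerOpCoeff_X_mul, eulerOpCoeff_X_mul, eulerOpCoeff_X_mul,
    eulerOpCoeff_scalar_mul, eulerOpCoeff_scalar_mul, h2]
  linear_combination PowerSeries.X * scalar s * h3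

theorem eulerOpCoeff_gen_liShuffleOne (s t : ℝ) :
    PowerSeries.C (1 - PowerSeries.X) * eulerOpCoeff (gen s t liShuffleOne) =
      PowerSeries.X * (scalar s * (PowerSeries.C (1 - PowerSeries.X) *
        gen s t fun m n => liCons 1 (liShuffleOne m n))) +
      PowerSeries.C PowerSeries.X * gen s t liShuffle := by
  have h1 : eulerOpCoeff (gen s t liShuffleOne) =
      PowerSeries.X * (scalar s * gen s t fun m n => liCons 1 (liShuffleOne m n)) +
      eulerOpCoeff (gen s t fun m n => liCons 1 (liShuffle m n)) := by
    rw [eulerOpCoeff_gen s t fun m n => liCons 1 (liShuffle m n), ← gen_shiftLeft, ← gen_add,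
      eulerOpCoeff_gen]
    simp only [eulerOp_liShuffleOne]
  rw [h1, mul_add, C_mul_eulerOpCoeff_gen]
  ring

/-- The generating function `∑ xᵖ Li_{{2}^p} hᵖ`. -/
noncomputable def genTwos (x : ℝ) : PowerSeries (PowerSeries ℝ) :=
  PowerSeries.mk fun p => PowerSeries.C (x ^ p) * li (twos p)

theorem eulerOpCoeff_genTwos (x : ℝ) :
    PowerSeries.C (1 - PowerSeries.X) * eulerOpCoeff (eulerOpCoeff (genTwos x)) =
      PowerSeries.X * (scalar x * (PowerSeries.C PowerSeries.X * genTwos x)) := by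
  have hC : ∀ (c : ℝ) (f : PowerSeries ℝ),
      eulerOp (PowerSeries.C c * f) = PowerSeries.C c * eulerOp f := by
    intro c f
    rw [← PowerSeries.smul_eq_C_mul, Derivation.map_smul, PowerSeries.smul_eq_C_mul]
  ext1 p
  cases p with
  | zero =>
    rw [PowerSeries.coeff_C_mul, coeff_eulerOpCoeff, coeff_eulerOpCoeff]
    simp [genTwos, twos, li]
  | succ p =>
    rw [PowerSeries.coeff_succ_X_mul]
    simp only [PowerSeries.coeff_C_mul, coeff_eulerOpCoeff, genTwos, PowerSeries.coeff_mk, hC,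
      twos_succ, li, eulerOp_liCons 0]
    rw [pow_succ, map_mul]
    linear_combination PowerSeries.C (x ^ p) * PowerSeries.C x *
      one_sub_X_mul_eulerOp_liCons (li (twos p))

theorem coeff_zero_liCons (a : ℕ) (f : PowerSeries ℝ) :
    PowerSeries.coeff 0 (liCons a f) = 0 := by
  rw [coeff_liCons, Finset.sum_range_zero, zero_div]

theorem coeff_zero_liShuffleOne (m n : ℕ) : PowerSeries.coeff 0 (liShuffleOne m n) = 0 := by
  cases m
  · rw [liShuffleOne_zero, coeff_zero_liCons]
  · rw [liShuffleOne_succ, map_add, coeff_zero_liCons, coeff_zero_liCons, add_zero]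

theorem coeff_zero_liShuffle (m n : ℕ) :
    PowerSeries.coeff 0 (liShuffle m n) = if m = 0 ∧ n = 0 then 1 else 0 := by
  cases m <;> cases n
  · simp [liShuffle_zero_zero]
  · simp only [liShuffle_zero_succ, coeff_zero_liCons]
    simp
  · simp only [liShuffle_succ_zero, coeff_zero_liCons]
    simp
  · simp only [liShuffle_succ_succ, map_add, coeff_zero_liCons]
    simp

theorem map_coeff_zero_eulerOpCoeff (F : PowerSeries (PowerSeries ℝ)) :
    PowerSeries.map (PowerSeries.constantCoeff (R := ℝ)) (eulerOpCoeff F) = 0 := by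
  ext N
  rw [PowerSeries.coeff_map, coeff_eulerOpCoeff, ← PowerSeries.coeff_zero_eq_constantCoeff_apply,
    coeff_eulerOp]
  simp

theorem map_coeff_zero_genTwos (x : ℝ) :
    PowerSeries.map (PowerSeries.constantCoeff (R := ℝ)) (genTwos x) = 1 := by
  ext p
  rw [PowerSeries.coeff_map, genTwos, PowerSeries.coeff_mk, map_mul, PowerSeries.coeff_one,
    PowerSeries.constantCoeff_C, ← PowerSeries.coeff_zero_eq_constantCoeff_apply]
  cases p with
  | zero => simp [twos, li]
  | succ p => rw [twos_succ, li, coeff_zero_liCons, mul_zero, if_neg (by omega)]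

theorem map_coeff_zero_gen_liShuffle (s t : ℝ) :
    PowerSeries.map (PowerSeries.constantCoeff (R := ℝ)) (gen s t liShuffle) = 1 := by
  ext N
  rw [PowerSeries.coeff_map, coeff_gen, map_sum, PowerSeries.coeff_one, Finset.sum_range_succ',
    Finset.sum_eq_zero, zero_add, if_pos (by omega), PowerSeries.smul_eq_C_mul, map_mul,
    PowerSeries.constantCoeff_C, ← PowerSeries.coeff_zero_eq_constantCoeff_apply,
    coeff_zero_liShuffle]
  · rcases Nat.eq_zero_or_pos N with rfl | hN
    · simp
    · simp [hN.ne']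
  · intro n _
    split_ifs
    · rw [PowerSeries.smul_eq_C_mul, map_mul,
        ← PowerSeries.coeff_zero_eq_constantCoeff_apply (liShuffle _ _), coeff_zero_liShuffle,
        if_neg (by omega), mul_zero]
    · rw [map_zero]

theorem map_coeff_zero_gen_of_eq_zero (s t : ℝ) {g : ℕ → ℕ → PowerSeries ℝ}
    (hg : ∀ m n, PowerSeries.coeff 0 (g m n) = 0) :
    PowerSeries.map (PowerSeries.constantCoeff (R := ℝ)) (gen s t g) = 0 := by
  ext N
  rw [PowerSeries.coeff_map, coeff_gen, map_sum, map_zero]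
  refine Finset.sum_eq_zero fun n _ => ?_
  split_ifs
  · rw [PowerSeries.smul_eq_C_mul, map_mul,
      ← PowerSeries.coeff_zero_eq_constantCoeff_apply (g _ _), hg, mul_zero]
  · rw [map_zero]

/-- The shuffle identity: `∑ xᵖ y^q Li_{{2}^p} Li_{{2}^q}` regroups as
`∑ (x + y)ᵐ (4 x y)ⁿ Li_{{2}^m ⧢ {3,1}^n}`. Both sides solve the same system of differential
equations. -/
theorem genTwos_mul_genTwos (x y : ℝ) :
    genTwos x * genTwos y = gen (x + y) (4 * (x * y)) liShuffle := by
  have hf := eulerOpCoeff_genTwos x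
  have hg := eulerOpCoeff_genTwos y
  have hT := eulerOpCoeff_gen_liShuffle (x + y) (4 * (x * y))
  have hT' := eulerOpCoeff_gen_liShuffleOne (x + y) (4 * (x * y))
  have hS := C_mul_eulerOpCoeff_gen (x + y) (4 * (x * y)) liShuffleOne
  have hf0 := map_coeff_zero_genTwos x
  have hg0 := map_coeff_zero_genTwos y
  have hT0 := map_coeff_zero_gen_liShuffle (x + y) (4 * (x * y))
  have hT'0 := map_coeff_zero_gen_of_eq_zero (x + y) (4 * (x * y)) coeff_zero_liShuffleOne
  have hS0 := map_coeff_zero_gen_of_eq_zero (x + y) (4 * (x * y))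
    fun m n => coeff_zero_liCons 1 (liShuffleOne m n)
  have hDf0 := map_coeff_zero_eulerOpCoeff (genTwos x)
  have hDg0 := map_coeff_zero_eulerOpCoeff (genTwos y)
  have hs : scalar (x + y) = scalar x + scalar y := by
    simp only [scalar, map_add]
  have ht : scalar (4 * (x * y)) = 4 * (scalar x * scalar y) := by
    simp only [scalar, map_mul, map_ofNat]
  have ht2 : scalar (2 * (x * y)) = 2 * (scalar x * scalar y) := by
    simp only [scalar, map_mul, map_ofNat]
  rw [hs, ht] at hT
  rw [hs] at hT'
  generalize gen (x + y) (4 * (x * y)) liShuffle = T at *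
  generalize gen (x + y) (4 * (x * y)) liShuffleOne = T' at *
  generalize (gen (x + y) (4 * (x * y)) fun m n => liCons 1 (liShuffleOne m n)) = S at *
  generalize genTwos x = f at *
  generalize genTwos y = g at *
  have conv : ∀ F : PowerSeries (PowerSeries ℝ),
      PowerSeries.map (PowerSeries.constantCoeff (R := ℝ)) F = 0 →
      ∀ N, PowerSeries.coeff 0 (PowerSeries.coeff N F) = 0 := by
    intro F hF N
    have := congrArg (PowerSeries.coeff N) hF
    rwa [PowerSeries.coeff_map, map_zero,
      ← PowerSeries.coeff_zero_eq_constantCoeff_apply] at this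
  have leib : ∀ F G : PowerSeries (PowerSeries ℝ), eulerOpCoeff (F * G) =
      F * eulerOpCoeff G + G * eulerOpCoeff F := eulerOpCoeff.leibniz
  -- the companions of `f g` are `Θ f Θ g` and `(x f Θ g + y g Θ f)`; on the shuffle side they are
  -- `2 x y h² S` and `2 x y h T'`, where the factor `2 x y = t / 2` absorbs the `2` from the
  -- second derivative of the product `f g`
  refine sub_eq_zero.1 (system_eq_zero (s := x + y) (t := 2 * (x * y))
    (v := eulerOpCoeff f * eulerOpCoeff g -
      PowerSeries.X * (PowerSeries.X * (scalar (2 * (x * y)) * S)))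
    (w := scalar x * (f * eulerOpCoeff g) + scalar y * (g * eulerOpCoeff f) -
      PowerSeries.X * (scalar (2 * (x * y)) * T'))
    (conv _ ?_) (conv _ ?_) (conv _ ?_) ?_ ?_ ?_)
  · rw [map_sub, map_mul, hf0, hg0, hT0]
    ring
  · simp only [map_sub, map_mul, hDf0, hS0]
    ring
  · simp only [map_sub, map_add, map_mul, hDf0, hDg0, hT'0]
    ring
  · have h : eulerOpCoeff (eulerOpCoeff (f * g - T)) = f * eulerOpCoeff (eulerOpCoeff g) +
        2 * (eulerOpCoeff f * eulerOpCoeff g) + g * eulerOpCoeff (eulerOpCoeff f) -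
        eulerOpCoeff (eulerOpCoeff T) := by
      rw [map_sub, leib, map_sub, map_add, leib, leib]
      ring
    have hsx : PowerSeries.C (PowerSeries.X * PowerSeries.C (x + y)) =
        PowerSeries.C PowerSeries.X * (scalar x + scalar y) := by
      rw [map_mul, ← hs]
    have h2 : PowerSeries.C (2 * (1 - PowerSeries.X : PowerSeries ℝ)) =
        2 * PowerSeries.C (1 - PowerSeries.X) := by
      rw [map_mul, map_ofNat]
    rw [h, hsx, h2, ht2]
    linear_combination g * hf + f * hg - hT
  · rw [eulerOpCoeff.map_sub, leib, eulerOpCoeff_X_mul, eulerOpCoeff_X_mul,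
      eulerOpCoeff_scalar_mul, ht2]
    linear_combination eulerOpCoeff g * hf + eulerOpCoeff f * hg -
      PowerSeries.X ^ 2 * (2 * (scalar x * scalar y)) * hS
  · have hsx : PowerSeries.C ((1 - PowerSeries.X) * PowerSeries.C (x + y)) =
        PowerSeries.C (1 - PowerSeries.X) * (scalar x + scalar y) := by
      rw [map_mul, ← hs]
    have htx : PowerSeries.C (PowerSeries.X * PowerSeries.C (2 * (x * y))) =
        PowerSeries.C PowerSeries.X * (2 * (scalar x * scalar y)) := by
      rw [map_mul, ← ht2]
    rw [eulerOpCoeff.map_sub, eulerOpCoeff.map_add, eulerOpCoeff_X_mul,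
      eulerOpCoeff_scalar_mul, eulerOpCoeff_scalar_mul, eulerOpCoeff_scalar_mul, leib, leib,
      hsx, htx, ht2]
    linear_combination scalar x * f * hg + scalar y * g * hf -
      PowerSeries.X * (2 * (scalar x * scalar y)) * hT'

/-! ### The values `ζ(2, …, 2)` -/

/-- The partial sums of the series `ζ(2, …, 2)` of depth `p`: the sum over all indices less than
`K`. -/
noncomputable def twosPartial (p K : ℕ) : ℝ :=
  ∑ j ∈ Finset.range K, PowerSeries.coeff j (li (twos p))

theorem coeff_li_twos_succ (p k : ℕ) :
    PowerSeries.coeff k (li (twos (p + 1))) = twosPartial p k / (k : ℝ) ^ 2 := by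
  rw [twos_succ, li, coeff_liCons, twosPartial]

theorem twosPartial_nonneg (p K : ℕ) : 0 ≤ twosPartial p K :=
  Finset.sum_nonneg fun _ _ => coeff_li_nonneg _ _

theorem twosPartial_succ_succ (p K : ℕ) :
    twosPartial (p + 1) (K + 1) = twosPartial (p + 1) K + twosPartial p K / (K : ℝ) ^ 2 := by
  rw [twosPartial, Finset.sum_range_succ, coeff_li_twos_succ]
  rfl

theorem twosPartial_zero_succ (K : ℕ) : twosPartial 0 (K + 1) = 1 := by
  simp [twosPartial, twos, li, PowerSeries.coeff_one]

theorem twosPartial_succ_one (p : ℕ) : twosPartial (p + 1) 1 = 0 := by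
  simp [twosPartial, twos_succ, li, liCons]

theorem twosPartial_le (p K : ℕ) : twosPartial p K ≤ (∑' k : ℕ, 1 / (k : ℝ) ^ 2) ^ p := by
  have hs : Summable fun k : ℕ => 1 / (k : ℝ) ^ 2 := Real.summable_one_div_nat_pow.2 one_lt_two
  induction p generalizing K with
  | zero =>
    cases K with
    | zero => simp [twosPartial]
    | succ K => rw [twosPartial_zero_succ, pow_zero]
  | succ p ih =>
    calc twosPartial (p + 1) K
        ≤ ∑ k ∈ Finset.range K, (∑' k : ℕ, 1 / (k : ℝ) ^ 2) ^ p * (1 / (k : ℝ) ^ 2) := by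
          refine Finset.sum_le_sum fun k _ => ?_
          rw [coeff_li_twos_succ, div_eq_mul_one_div]
          exact mul_le_mul_of_nonneg_right (ih k) (by positivity)
      _ ≤ _ := by
          rw [← Finset.mul_sum, pow_succ]
          refine mul_le_mul_of_nonneg_left (hs.sum_le_tsum _ fun _ _ => by positivity) ?_
          exact pow_nonneg (tsum_nonneg fun _ => by positivity) _

theorem summable_coeff_li_twos (p : ℕ) : Summable fun k => PowerSeries.coeff k (li (twos p)) :=
  summable_of_sum_range_le (fun k => coeff_li_nonneg _ k) (twosPartial_le p)

/-- The partial sums of `ζ(2, …, 2)` are the elementary symmetric functions of `1 / j ^ 2`, so they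
are the coefficients of the partial products of the sine product. -/
theorem hasSum_twosPartial (n : ℕ) (x : ℂ) :
    HasSum (fun p => (twosPartial p (n + 1) : ℂ) * x ^ p)
      (∏ j ∈ Finset.range n, (1 + x / ((j : ℂ) + 1) ^ 2)) := by
  induction n with
  | zero =>
    rw [Finset.prod_range_zero]
    convert hasSum_single (f := fun p => (twosPartial p (0 + 1) : ℂ) * x ^ p) 0 ?_ using 1
    · simp [twosPartial_zero_succ]
    · intro p hp
      obtain ⟨q, rfl⟩ := Nat.exists_eq_succ_of_ne_zero hp
      simp [twosPartial_succ_one]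
  | succ n ih =>
    rw [Finset.prod_range_succ, mul_add, mul_one]
    rw [← hasSum_nat_add_iff' 1] at ih ⊢
    have h2 := ((hasSum_nat_add_iff' 1).1 ih).mul_right (x / ((n : ℂ) + 1) ^ 2)
    convert ih.add h2 using 1
    · funext p
      rw [twosPartial_succ_succ]
      push_cast
      ring
    · simp [twosPartial_zero_succ]
      ring

theorem hasSum_sin_div (w : ℂ) (hw : w ≠ 0) :
    HasSum (fun p : ℕ => ((Real.pi ^ (2 * p) / (2 * p + 1).factorial : ℝ) : ℂ) * (-w ^ 2) ^ p)
      (Complex.sin (Real.pi * w) / (Real.pi * w)) := by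
  have hpi : (Real.pi : ℂ) * w ≠ 0 := mul_ne_zero (by exact_mod_cast Real.pi_ne_zero) hw
  refine (congrArg (HasSum · _) (funext fun p => ?_)).mp
    ((Complex.hasSum_sin (Real.pi * w)).div_const (Real.pi * w))
  push_cast
  rw [neg_pow (w ^ 2), pow_succ ((Real.pi : ℂ) * w), mul_pow _ w (2 * p), pow_mul w]
  field_simp

/-- Euler's product for the sine gives `ζ(2, …, 2) = π ^ (2 p) / (2 p + 1)!` in depth `p`. -/
theorem hasSum_coeff_li_twos (p : ℕ) :
    HasSum (fun k => PowerSeries.coeff k (li (twos p)))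
      (Real.pi ^ (2 * p) / (2 * p + 1).factorial) := by
  set M : ℝ := ∑' k : ℕ, 1 / (k : ℝ) ^ 2
  have hM : 0 ≤ M := tsum_nonneg fun _ => by positivity
  let z : ℕ → ℝ := fun p => ∑' k, PowerSeries.coeff k (li (twos p))
  have hz : ∀ p, HasSum (fun k => PowerSeries.coeff k (li (twos p))) (z p) :=
    fun p => (summable_coeff_li_twos p).hasSum
  have hzM : ∀ p, z p ≤ M ^ p := fun p =>
    le_of_tendsto' (hz p).tendsto_sum_nat (twosPartial_le p)
  have hz0 : ∀ p, 0 ≤ z p := fun p => tsum_nonneg (coeff_li_nonneg _)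
  have hr : 0 < 1 / (M + 1) := by positivity
  have hgeom : ∀ x : ℂ, ‖x‖ < 1 / (M + 1) → Summable fun p => (M * ‖x‖) ^ p := by
    intro x hx
    refine summable_geometric_of_lt_one (by positivity) ?_
    calc M * ‖x‖ ≤ (M + 1) * ‖x‖ := by gcongr; linarith
      _ < 1 := by rwa [lt_div_iff₀' (by positivity)] at hx
  -- dominated convergence in the expansion of the partial products
  have hlim : ∀ w : ℂ, ‖-w ^ 2‖ < 1 / (M + 1) → w ≠ 0 →
      HasSum (fun p => (z p : ℂ) * (-w ^ 2) ^ p)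
        (Complex.sin (Real.pi * w) / (Real.pi * w)) := by
    intro w hx hw
    have hsum : Summable fun p => (z p : ℂ) * (-w ^ 2) ^ p := by
      refine Summable.of_norm_bounded (hgeom _ hx) fun p => ?_
      rw [norm_mul, norm_pow, mul_pow, Complex.norm_real, Real.norm_of_nonneg (hz0 p)]
      gcongr
      exact hzM p
    have h1 : Filter.Tendsto (fun n : ℕ => ∑' p, (twosPartial p (n + 1) : ℂ) * (-w ^ 2) ^ p)
        Filter.atTop (nhds (∑' p, (z p : ℂ) * (-w ^ 2) ^ p)) := by
      refine tendsto_tsum_of_dominated_convergence (hgeom _ hx) (fun p => ?_)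
        (Filter.Eventually.of_forall fun n p => ?_)
      · refine Filter.Tendsto.mul_const _ ?_
        exact (Complex.continuous_ofReal.tendsto _).comp
          (((hz p).tendsto_sum_nat).comp (Filter.tendsto_add_atTop_nat 1))
      · rw [norm_mul, norm_pow, mul_pow, Complex.norm_real,
          Real.norm_of_nonneg (twosPartial_nonneg _ _)]
        gcongr
        exact twosPartial_le _ _
    have hpi : (Real.pi : ℂ) * w ≠ 0 := mul_ne_zero (by exact_mod_cast Real.pi_ne_zero) hw
    have h2 := (Complex.tendsto_euler_sin_prod w).div_const (Real.pi * w)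
    have h3 := tendsto_nhds_unique h1 (h2.congr fun n => by
      rw [(hasSum_twosPartial n (-w ^ 2)).tsum_eq, mul_div_cancel_left₀ _ hpi]
      exact Finset.prod_congr rfl fun j _ => by ring)
    rw [← h3]
    exact hsum.hasSum
  have hz_zero : z 0 = 1 := by
    have h := hz 0
    have h' : HasSum (fun k => PowerSeries.coeff k (li (twos 0))) 1 := by
      convert hasSum_ite_eq (0 : ℕ) (1 : ℝ) using 2 with k
      simp [twos, li, PowerSeries.coeff_one]
    exact h.unique h'
  -- the two power series agree near the origin
  let f : ℂ → ℂ := fun x => ∑' p, (z p : ℂ) * x ^ p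
  have hev : ∀ᶠ x : ℂ in nhds 0, HasSum (fun p => (z p : ℂ) * x ^ p) (f x) ∧
      HasSum (fun p : ℕ => ((Real.pi ^ (2 * p) / (2 * p + 1).factorial : ℝ) : ℂ) * x ^ p)
        (f x) := by
    filter_upwards [Metric.ball_mem_nhds (0 : ℂ) hr] with x hx
    rw [mem_ball_zero_iff] at hx
    by_cases hx0 : x = 0
    · have key : ∀ c : ℕ → ℂ, c 0 = 1 → HasSum (fun p => c p * x ^ p) 1 := by
        intro c hc
        convert hasSum_ite_eq (0 : ℕ) (1 : ℂ) using 2 with p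
        rcases Nat.eq_zero_or_pos p with rfl | hp
        · simp [hc]
        · simp [hx0, hp.ne']
      have k1 := key (fun p => z p) (by simp [hz_zero])
      have k2 := key (fun p => ((Real.pi ^ (2 * p) / (2 * p + 1).factorial : ℝ) : ℂ)) (by simp)
      have hfx : f x = 1 := k1.tsum_eq
      rw [hfx]
      exact ⟨k1, k2⟩
    · obtain ⟨w, hw⟩ := IsAlgClosed.exists_pow_nat_eq (-x) (n := 2) two_pos
      have hxw : x = -w ^ 2 := by rw [hw, neg_neg]
      have hw0 : w ≠ 0 := by
        rintro rfl
        simp at hxw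
        exact hx0 hxw
      have k1 := hlim w (hxw ▸ hx) hw0
      have k2 := hasSum_sin_div w hw0
      rw [← hxw] at k1 k2
      have hfx : f x = _ := k1.tsum_eq
      rw [hfx]
      exact ⟨k1, k2⟩
  have hps : ∀ c : ℕ → ℂ, (∀ᶠ x : ℂ in nhds 0, HasSum (fun p => c p * x ^ p) (f x)) →
      HasFPowerSeriesAt f (FormalMultilinearSeries.ofScalars ℂ c) 0 := by
    intro c hc
    rw [hasFPowerSeriesAt_iff]
    filter_upwards [hc] with x hx
    simpa [mul_comm] using hx
  have heq := (hps _ (hev.mono fun x hx => hx.1)).eq_formalMultilinearSeries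
    (hps _ (hev.mono fun x hx => hx.2))
  have hcoeff := congrArg (fun q => FormalMultilinearSeries.coeff q p) heq
  simp only [FormalMultilinearSeries.coeff_ofScalars] at hcoeff
  rw [← Complex.ofReal_injective hcoeff]
  exact hz p

/-! ### Convergence and evaluation at `X = 1` -/

theorem hasSum_sum_mul_antidiagonal {f g : ℕ → ℝ} {a b : ℝ} (hf0 : ∀ k, 0 ≤ f k)
    (hg0 : ∀ k, 0 ≤ g k) (hf : HasSum f a) (hg : HasSum g b) :
    HasSum (fun k => ∑ i ∈ Finset.HasAntidiagonal.antidiagonal k, f i.1 * g i.2) (a * b) := by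
  have h : Summable fun i : ℕ × ℕ => f i.1 * g i.2 :=
    hf.summable.mul_of_nonneg hg.summable hf0 hg0
  have h1 := hf.summable.tsum_mul_tsum_eq_tsum_sum_antidiagonal hg.summable h
  have h2 := summable_sum_mul_antidiagonal_of_summable_mul h
  rw [hf.tsum_eq, hg.tsum_eq] at h1
  rw [h1]
  exact h2.hasSum

theorem hasSum_coeff_mul {f g : PowerSeries ℝ} {a b : ℝ}
    (hf0 : ∀ k, 0 ≤ PowerSeries.coeff k f) (hg0 : ∀ k, 0 ≤ PowerSeries.coeff k g)
    (hf : HasSum (fun k => PowerSeries.coeff k f) a)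
    (hg : HasSum (fun k => PowerSeries.coeff k g) b) :
    HasSum (fun k => PowerSeries.coeff k (f * g)) (a * b) := by
  have e : (fun k => PowerSeries.coeff k (f * g)) = fun k : ℕ =>
      ∑ i ∈ Finset.HasAntidiagonal.antidiagonal k,
        PowerSeries.coeff i.1 f * PowerSeries.coeff i.2 g := by
    funext k
    exact PowerSeries.coeff_mul k f g
  rw [e]
  exact hasSum_sum_mul_antidiagonal (f := fun k => PowerSeries.coeff k f)
    (g := fun k => PowerSeries.coeff k g) (fun k => hf0 k) (fun k => hg0 k) hf hg

theorem hasSum_coeff_genTwos_mul (x y : ℝ) (N : ℕ) :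
    HasSum (fun k => PowerSeries.coeff k (PowerSeries.coeff N (genTwos x * genTwos y)))
      (∑ i ∈ Finset.HasAntidiagonal.antidiagonal N, x ^ i.1 * y ^ i.2 *
        (Real.pi ^ (2 * i.1) / (2 * i.1 + 1).factorial *
          (Real.pi ^ (2 * i.2) / (2 * i.2 + 1).factorial))) := by
  have h := hasSum_sum (s := Finset.HasAntidiagonal.antidiagonal N) fun i _ =>
    (hasSum_coeff_mul (coeff_li_nonneg _) (coeff_li_nonneg _)
      (hasSum_coeff_li_twos i.1) (hasSum_coeff_li_twos i.2)).mul_left (x ^ i.1 * y ^ i.2)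
  refine (congrArg (HasSum · _) (funext fun k => ?_)).mp h
  rw [PowerSeries.coeff_mul N, map_sum]
  refine Finset.sum_congr rfl fun i _ => ?_
  rw [genTwos, genTwos, PowerSeries.coeff_mk, PowerSeries.coeff_mk, mul_mul_mul_comm, ← map_mul,
    PowerSeries.coeff_C_mul]

theorem coeff_sum_map_li_nonneg (l : List (List ℕ)) (k : ℕ) :
    0 ≤ PowerSeries.coeff k (l.map li).sum := by
  induction l with
  | nil => simp
  | cons s l ih =>
    rw [List.map_cons, List.sum_cons, map_add]
    exact add_nonneg (coeff_li_nonneg s k) ih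

theorem coeff_li_le_coeff_sum {l : List (List ℕ)} {s : List ℕ} (hs : s ∈ l) (k : ℕ) :
    PowerSeries.coeff k (li s) ≤ PowerSeries.coeff k (l.map li).sum := by
  induction l with
  | nil => simp at hs
  | cons a l ih =>
    rw [List.map_cons, List.sum_cons, map_add]
    rcases List.mem_cons.1 hs with rfl | hs
    · exact le_add_of_nonneg_right (coeff_sum_map_li_nonneg l k)
    · exact (ih hs).trans (le_add_of_nonneg_left (coeff_li_nonneg a k))

/-- At `x = y = 1` the shuffle identity bounds `Li_{{2}^m ⧢ {3,1}^n}` by a sum of products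
`Li_{{2}^p} Li_{{2}^q}`, since all its terms are nonnegative. -/
theorem summable_coeff_liShuffle (m n : ℕ) :
    Summable fun k => PowerSeries.coeff k (liShuffle m n) := by
  have h := (hasSum_coeff_genTwos_mul 1 1 (m + 2 * n)).summable
  have hc : (0 : ℝ) < 2 ^ m * 4 ^ n := by positivity
  refine (summable_mul_left_iff hc.ne').1 (Summable.of_nonneg_of_le
    (fun k => mul_nonneg hc.le (coeff_sum_map_li_nonneg _ k)) (fun k => ?_) h)
  rw [genTwos_mul_genTwos, coeff_gen, map_sum]
  have hn : n ∈ Finset.range (m + 2 * n + 1) := Finset.mem_range.2 (by omega)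
  refine le_trans (le_of_eq ?_) (Finset.single_le_sum (fun j _ => ?_) hn)
  · rw [if_pos (by omega), Nat.add_sub_cancel, PowerSeries.coeff_smul, smul_eq_mul]
    norm_num
  · split_ifs
    · rw [PowerSeries.coeff_smul, smul_eq_mul]
      exact mul_nonneg (by positivity) (coeff_sum_map_li_nonneg _ k)
    · simp

theorem summable_coeff_li_of_mem {m n : ℕ} {s : List ℕ}
    (hs : s ∈ shuffle (twos m) (threeOnes n)) : Summable fun k => PowerSeries.coeff k (li s) :=
  Summable.of_nonneg_of_le (coeff_li_nonneg s) (coeff_li_le_coeff_sum hs)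
    (summable_coeff_liShuffle m n)

theorem hasSum_coeff_sum_map_li (l : List (List ℕ))
    (hl : ∀ s ∈ l, Summable fun k => PowerSeries.coeff k (li s)) :
    HasSum (fun k => PowerSeries.coeff k (l.map li).sum) (l.map mzv).sum := by
  induction l with
  | nil => simp
  | cons s l ih =>
    simp only [List.map_cons, List.sum_cons, map_add]
    have hs := hl s List.mem_cons_self
    refine HasSum.add ?_ (ih fun w hw => hl w (List.mem_cons_of_mem s hw))
    rw [mzv, (hasSum_mzvTerm hs).tsum_eq]
    exact hs.hasSum

/-- The sum of `ζ(w)` over the words `w` in the shuffle of `{2}^m` and `{3,1}^n`. -/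
noncomputable def mzvShuffle (m n : ℕ) : ℝ :=
  ((shuffle (twos m) (threeOnes n)).map mzv).sum

theorem sum_antidiagonal_eq_sum_mzvShuffle (x y : ℝ) (N : ℕ) :
    ∑ i ∈ Finset.HasAntidiagonal.antidiagonal N, x ^ i.1 * y ^ i.2 *
        (Real.pi ^ (2 * i.1) / (2 * i.1 + 1).factorial *
          (Real.pi ^ (2 * i.2) / (2 * i.2 + 1).factorial)) =
      ∑ n ∈ Finset.range (N + 1), if 2 * n ≤ N then
        (x + y) ^ (N - 2 * n) * (4 * (x * y)) ^ n * mzvShuffle (N - 2 * n) n else 0 := by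
  have h := hasSum_coeff_genTwos_mul x y N
  rw [genTwos_mul_genTwos] at h
  refine h.unique ?_
  simp only [coeff_gen, map_sum]
  refine hasSum_sum fun n _ => ?_
  split_ifs
  · simp only [PowerSeries.coeff_smul, smul_eq_mul]
    exact (hasSum_coeff_sum_map_li _ fun s hs => summable_coeff_li_of_mem hs).mul_left _
  · simp

/-! ### Comparison of coefficients -/

/-- Twice the odd part of the binomial expansion. The terms with `2 j + 1 > M`, where the exponent
of `u` is truncated, vanish with the binomial coefficient. -/
theorem add_pow_sub_sub_pow (u v : ℝ) (M : ℕ) : (u + v) ^ M - (u - v) ^ M =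
    ∑ j ∈ Finset.range M, 2 * (M.choose (2 * j + 1) * u ^ (M - (2 * j + 1)) * v ^ (2 * j + 1)) := by
  rcases Nat.eq_zero_or_pos M with rfl | hM
  · simp
  have hext : ∀ w : ℝ, (u + w) ^ M =
      ∑ k ∈ Finset.range (2 * M), w ^ k * u ^ (M - k) * M.choose k := by
    intro w
    rw [add_comm, add_pow]
    refine Finset.sum_subset (Finset.range_subset_range.2 (by omega)) fun k _ hk => ?_
    rw [Nat.choose_eq_zero_of_lt (by simpa using hk)]
    simp
  have hpair : ∀ (f : ℕ → ℝ) (K : ℕ), ∑ k ∈ Finset.range (2 * K), f k =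
      ∑ j ∈ Finset.range K, (f (2 * j) + f (2 * j + 1)) := by
    intro f K
    induction K with
    | zero => simp
    | succ K ih =>
      rw [Nat.mul_succ, Finset.sum_range_succ, Finset.sum_range_succ, ih, Finset.sum_range_succ]
      ring
  rw [sub_eq_add_neg u v, hext, hext, hpair, hpair, ← Finset.sum_sub_distrib]
  refine Finset.sum_congr rfl fun j _ => ?_
  have h1 : (-v) ^ (2 * j) = v ^ (2 * j) := by rw [pow_mul, neg_sq, ← pow_mul]
  rw [pow_succ (-v), h1]
  ring

/-- The closed form of `mzvShuffle m n`. -/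
noncomputable def shuffleValue (m n : ℕ) : ℝ :=
  ((2 * n + m).choose m : ℝ) *
    (Real.pi ^ (4 * n + 2 * m) / ((2 * n + 1 : ℝ) * ((4 * n + 2 * m + 1).factorial : ℝ)))

/-- With `x = a ^ 2` and `y = b ^ 2`, both sides are multiples of
`(a + b) ^ (2 N + 2) - (a - b) ^ (2 N + 2)`, which is expanded in powers of `a` and `b` on the left
and in powers of `a ^ 2 + b ^ 2` and `2 a b` on the right. -/
theorem sum_antidiagonal_eq_sum_shuffleValue {x y : ℝ} (hx : 0 < x) (hy : 0 < y) (N : ℕ) :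
    ∑ i ∈ Finset.HasAntidiagonal.antidiagonal N, x ^ i.1 * y ^ i.2 *
        (Real.pi ^ (2 * i.1) / (2 * i.1 + 1).factorial *
          (Real.pi ^ (2 * i.2) / (2 * i.2 + 1).factorial)) =
      ∑ n ∈ Finset.range (N + 1), if 2 * n ≤ N then
        (x + y) ^ (N - 2 * n) * (4 * (x * y)) ^ n * shuffleValue (N - 2 * n) n else 0 := by
  obtain ⟨a, ha, rfl⟩ : ∃ a : ℝ, 0 < a ∧ a ^ 2 = x := ⟨√x, Real.sqrt_pos.2 hx, Real.sq_sqrt hx.le⟩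
  obtain ⟨b, hb, rfl⟩ : ∃ b : ℝ, 0 < b ∧ b ^ 2 = y := ⟨√y, Real.sqrt_pos.2 hy, Real.sq_sqrt hy.le⟩
  set c : ℝ := 2 * a * b * (2 * N + 2).factorial / Real.pi ^ (2 * N) with hc
  have hc0 : c ≠ 0 := by positivity
  apply mul_left_cancel₀ hc0
  have hL := add_pow_sub_sub_pow b a (2 * N + 2)
  have hR := add_pow_sub_sub_pow (a ^ 2 + b ^ 2) (2 * a * b) (N + 1)
  have e1 : a ^ 2 + b ^ 2 + 2 * a * b = (b + a) ^ 2 := by ring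
  have e2 : a ^ 2 + b ^ 2 - 2 * a * b = (b - a) ^ 2 := by ring
  rw [e1, e2, ← pow_mul, ← pow_mul, Nat.mul_succ, hL] at hR
  rw [Finset.mul_sum, Finset.mul_sum, Finset.Nat.sum_antidiagonal_eq_sum_range_succ_mk]
  refine Eq.trans ?_ (hR.trans ?_)
  · rw [← Finset.sum_subset (Finset.range_subset_range.2 (by omega : N + 1 ≤ 2 * N + 2))]
    · refine Finset.sum_congr rfl fun p hp => ?_
      obtain ⟨q, rfl⟩ := Nat.exists_eq_add_of_le (Nat.lt_succ_iff.1 (Finset.mem_range.1 hp))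
      have h1 : p + q - p = q := by omega
      have h2 : 2 * (p + q) + 2 - (2 * p + 1) = 2 * q + 1 := by omega
      rw [Nat.cast_choose ℝ (by omega : 2 * p + 1 ≤ 2 * (p + q) + 2)]
      simp only [h1, h2, hc]
      have hpi := Real.pi_ne_zero
      field_simp
      ring
    · intro j _ hj
      rw [Finset.mem_range, not_lt] at hj
      rw [Nat.choose_eq_zero_of_lt (by omega)]
      simp
  · refine Finset.sum_congr rfl fun n _ => ?_
    split_ifs with hn
    · obtain ⟨m, rfl⟩ := Nat.exists_eq_add_of_le' hn
      have h1 : m + 2 * n - 2 * n = m := by omega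
      have h2 : m + 2 * n + 1 - (2 * n + 1) = m := by omega
      have h3 : ((2 * n + m).choose m : ℝ) * (m + 2 * n + 1) =
          (m + 2 * n + 1).choose (2 * n + 1) * (2 * n + 1) := by
        have := Nat.add_one_mul_choose_eq (m + 2 * n) (2 * n)
        rw [← Nat.choose_symm_add, Nat.add_comm (2 * n) m, mul_comm]
        exact_mod_cast this
      have h4 : ((2 * (m + 2 * n) + 2).factorial : ℝ) =
          2 * (m + 2 * n + 1) * (4 * n + 2 * m + 1).factorial := by
        have e : 2 * (m + 2 * n) + 2 = 4 * n + 2 * m + 1 + 1 := by omega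
        rw [e, Nat.factorial_succ]
        push_cast
        ring
      have h5 : 4 * n + 2 * m = 2 * (m + 2 * n) := by omega
      have h6 : 4 * (a ^ 2 * b ^ 2) = (2 * a * b) ^ 2 := by ring
      rw [h1, h2, shuffleValue, hc, h4, h5, h6, ← pow_mul, pow_succ (2 * a * b)]
      have hpi := Real.pi_ne_zero
      have hn1 : (2 * n + 1 : ℝ) ≠ 0 := by positivity
      generalize (2 * a * b) ^ (2 * n) = d
      field_simp
      linear_combination -d * h3
    · rw [Nat.choose_eq_zero_of_lt (by omega)]
      simp

theorem mzvShuffle_eq_shuffleValue (m n : ℕ) : mzvShuffle m n = shuffleValue m n := by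
  set N := m + 2 * n with hN
  let D : Polynomial ℝ := ∑ j ∈ Finset.range (N + 1), if 2 * j ≤ N then
    Polynomial.C (mzvShuffle (N - 2 * j) j - shuffleValue (N - 2 * j) j) * Polynomial.X ^ j else 0
  -- `x + y = 1` and `4 x y = t` is solvable in positive reals for `0 < t < 1`
  have hroot : ∀ t ∈ Set.Ioo (0 : ℝ) 1, D.IsRoot t := by
    rintro t ⟨ht0, ht1⟩
    set r := √(1 - t) with hr
    have hr2 : r ^ 2 = 1 - t := Real.sq_sqrt (by linarith)
    have hr1 : r < 1 := by
      rw [hr, Real.sqrt_lt' one_pos]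
      linarith
    have hr0 : 0 ≤ r := Real.sqrt_nonneg _
    have h1 := sum_antidiagonal_eq_sum_mzvShuffle ((1 + r) / 2) ((1 - r) / 2) N
    rw [sum_antidiagonal_eq_sum_shuffleValue (by linarith) (by linarith)] at h1
    have e1 : (1 + r) / 2 + (1 - r) / 2 = 1 := by ring
    have e2 : 4 * ((1 + r) / 2 * ((1 - r) / 2)) = t := by linear_combination -hr2
    simp only [e1, e2, one_pow, one_mul] at h1
    rw [Polynomial.IsRoot.def, Polynomial.eval_finsetSum, ← sub_eq_zero.2 h1.symm,
      ← Finset.sum_sub_distrib]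
    refine Finset.sum_congr rfl fun j _ => ?_
    split_ifs
    · rw [Polynomial.eval_mul, Polynomial.eval_C, Polynomial.eval_pow, Polynomial.eval_X]
      ring
    · simp
  have hD : D = 0 := Polynomial.eq_zero_of_infinite_isRoot D
    ((Set.Ioo_infinite one_pos).mono hroot)
  have hcoeff := congrArg (fun q => Polynomial.coeff q n) hD
  simp only [D, Polynomial.finsetSum_coeff, Polynomial.coeff_zero] at hcoeff
  rw [Finset.sum_eq_single n] at hcoeff
  · rw [if_pos (by omega), Polynomial.coeff_C_mul, Polynomial.coeff_X_pow_self, mul_one, hN,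
      Nat.add_sub_cancel] at hcoeff
    exact sub_eq_zero.1 hcoeff
  · intro j _ hj
    split_ifs
    · rw [Polynomial.coeff_C_mul, Polynomial.coeff_X_pow, if_neg hj.symm, mul_zero]
    · simp
  · intro h
    exact absurd (Finset.mem_range.2 (by omega)) h

theorem theorem1 (m n : ℕ) (hm : 0 < m) (hn : 0 < n) :
    (∀ s ∈ shuffle (twos m) (threeOnes n), Summable (mzvTerm s)) ∧
    ((shuffle (twos m) (threeOnes n)).map mzv).sum =
      ((2 * n + m).choose m : ℝ) *
        (Real.pi ^ (4 * n + 2 * m) /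
          ((2 * n + 1 : ℝ) * ((4 * n + 2 * m + 1).factorial : ℝ))) :=
  ⟨fun _ hs => (hasSum_mzvTerm (summable_coeff_li_of_mem hs)).summable,
    mzvShuffle_eq_shuffleValue m n⟩
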